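/- Let $\mathbb F_q$ be a finite field with $q$ elements, and let $n,k,l,m,h$ be integers with $0\le m\le l$, $k=\frac{n-l-m}{2}\ge 2$ and $1\le h\le k-1$. Suppose $n\mid q-1$, and let $\lambda\in\mathbb F_q^*$ have multiplicative order dividing $\frac{q-1}{n}$. Let $\alpha_1,\dots,\alpha_n$ be all the (pairwise distinct) roots of $x^n-\lambda$ in $\mathbb F_q$, in any order. Let $v_1,\dots,v_n\in\mathbb F_q$ satisfy $v_i\notin\{-1,0,1\}$ for $1\le i\le k-1$ and $v_i\in\{1,-1\}$ for $k\le i\le n$. Let $\boldsymbol\eta=(\eta_0,\dots,\eta_l)\in\mathbb F_q^{l+1}$ and $$\mathcal C_h=\Big\{\big(v_1f(\alpha_1),\dots,v_nf(\alpha_n)\big)\ :\ f(x)=\sum_{i=0}^{k-1}f_ix^i+f_h\sum_{t=0}^{l}\eta_tx^{k+t},\ f_0,\dots,f_{k-1}\in\mathbb F_q\Big\}\subseteq\mathbb F_q^n.$$ Let $r_{h-1}$ be the coefficient of $x^{h-1}$ in the remainder of $x^{h-1}+\sum_{t=0}^{l}\eta_tx^{k+t-1}$ on division by $\prod_{i=1}^{k-1}(x-\alpha_i)$.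 For a $k$-subset $\mathcal I\subsetneq\{1,\dots,n\}$ write $\prod_{i\in\mathcal I}(x-\alpha_i)=\sum_{j=0}^{k}c_jx^{k-j}$, put $c_j=0$ for $j>k$, and for $0\le t\le l$ let $A_{\mathcal I,t}$ be the $(t+1)\times(t+1)$ lower triangular Toeplitz matrix whose $(a,b)$ entry is $c_{a-b}$ for $a\ge b$ and $0$ otherwise, $\boldsymbol c^{(h)}_t=(c_{k-h},c_{k-h+1},\dots,c_{k-h+t})^T$ and $\boldsymbol e_{t+1}=(0,\dots,0,1)^T$, both of length $t+1$. Let $\Phi$ be the set of all $\boldsymbol\eta\in\mathbb F_q^{l+1}\setminus\{\boldsymbol 0\}$ such that $$1-\sum_{t=0}^{l}\eta_t\,\boldsymbol e_{t+1}^TA_{\mathcal I,t}^{-1}\boldsymbol c^{(h)}_t\ne0\qquad\text{for every $k$-subset }\mathcal I\subsetneq\{1,\dots,n\}.$$ If $r_{h-1}\ne0$, $\sum_{t=m}^{l}\eta_t\eta_{l+m-t}=0$ and $\boldsymbol\eta\in\Phi$, then $\mathcal C_h$ is an LCD MDS code of length $n$ and dimension $k$; that is, $\dim\mathcal C_h=k$,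 $\mathcal C_h\cap\mathcal C_h^{\perp}=\{\boldsymbol 0\}$ for the standard dot product, and the minimum Hamming distance of $\mathcal C_h$ is $n-k+1$. -/

import Mathlib

open Polynomial

namespace TwistedRS

variable {F : Type*} [Field F]

/-- The Euclidean dual code `C^⊥`, with respect to the standard dot product. -/
def dualCode {n : ℕ} (C : Submodule F (Fin n → F)) : Submodule F (Fin n → F) :=
  C.orthogonalBilin (dotProductBilin F F)

/-- `C` is (Euclidean) linear complementary dual: its hull `C ∩ C^⊥` is zero. -/
def IsLCD {n : ℕ} (C : Submodule F (Fin n → F)) : Prop :=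
  C ⊓ dualCode C = ⊥

/-- The minimum Hamming distance between distinct codewords. -/
noncomputable def minDist [DecidableEq F] {n : ℕ} (C : Submodule F (Fin n → F)) : ℕ :=
  sInf {d | ∃ x ∈ C, ∃ y ∈ C, x ≠ y ∧ hammingDist x y = d}

/-- `C` is maximum distance separable: it meets the Singleton bound, `d = n - dim C + 1`. -/
def IsMDS [DecidableEq F] {n : ℕ} (C : Submodule F (Fin n → F)) : Prop :=
  minDist C + Module.finrank F C = n + 1

/-- The twisted polynomial `∑_{i<k} f_i x^i + f_h ∑_{t=0}^l η_t x^{k+t}`. -/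
noncomputable def twistedPoly {k l : ℕ} (h : Fin k) (η : Fin (l + 1) → F) (f : Fin k → F) : F[X] :=
  ∑ i : Fin k, C (f i) * X ^ (i : ℕ) + C (f h) * ∑ t : Fin (l + 1), C (η t) * X ^ (k + (t : ℕ))

/-- The `(L, P)`-TGRS code with `L = {0, …, l}` and `P = {h}`: all vectors
`(v_1 f(α_1), …, v_n f(α_n))` with `f` a twisted polynomial. -/
noncomputable def tgrsCode {n k l : ℕ} (α v : Fin n → F) (h : Fin k) (η : Fin (l + 1) → F) :
    Submodule F (Fin n → F) where
  carrier := {c | ∃ f : Fin k → F, c = fun i => v i * (twistedPoly h η f).eval (α i)}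
  zero_mem' := ⟨0, by ext i; simp [twistedPoly]⟩
  add_mem' := by
    rintro _ _ ⟨f, rfl⟩ ⟨g, rfl⟩
    refine ⟨f + g, ?_⟩
    ext i
    simp only [twistedPoly, Pi.add_apply, eval_add, eval_mul, eval_C, eval_finsetSum, eval_pow,
      eval_X, add_mul, Finset.sum_add_distrib]
    ring
  smul_mem' := by
    rintro a _ ⟨f, rfl⟩
    refine ⟨a • f, ?_⟩
    ext i
    simp only [twistedPoly, Pi.smul_apply, smul_eq_mul, eval_add, eval_mul, eval_C,
      eval_finsetSum, eval_pow, eval_X, mul_assoc, ← Finset.mul_sum]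
    ring

/-- The coefficients `c_j` in `∏_{i ∈ I} (x - α_i) = ∑_{j=0}^k c_j x^{k-j}` (for `#I = k`),
with `c_j = 0` for `j > k`. -/
noncomputable def nodeCoeff {n : ℕ} (k : ℕ) (α : Fin n → F) (I : Finset (Fin n)) (j : ℕ) : F :=
  if j ≤ k then (∏ i ∈ I, (X - C (α i))).coeff (k - j) else 0

/-- The lower triangular Toeplitz matrix `A_{I,t}` of size `t + 1` with entries `c_{a-b}`, `b ≤ a`. -/
noncomputable def toeplitz {n : ℕ} (k : ℕ) (α : Fin n → F) (I : Finset (Fin n)) (t : ℕ) :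
    Matrix (Fin (t + 1)) (Fin (t + 1)) F :=
  Matrix.of fun a b => if b ≤ a then nodeCoeff k α I ((a : ℕ) - (b : ℕ)) else 0

/-- The column vector `c_t^{(h)} = (c_{k-h}, c_{k-h+1}, …, c_{k-h+t})`. -/
noncomputable def coeffVec {n k : ℕ} (α : Fin n → F) (I : Finset (Fin n)) (h : Fin k) (t : ℕ) :
    Fin (t + 1) → F :=
  fun i => nodeCoeff k α I (k - (h : ℕ) + (i : ℕ))

open Matrix in
/-- The set `Φ` of nonzero `η` such that `1 - ∑_t η_t e_{t+1}^T A_{I,t}⁻¹ c_t^{(h)} ≠ 0` for all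
`k`-subsets `I ⊊ {1, …, n}`; here `e_{t+1} = (0, …, 0, 1)^T` has length `t + 1`. -/
def Phi {n k : ℕ} (l : ℕ) (α : Fin n → F) (h : Fin k) : Set (Fin (l + 1) → F) :=
  {η | η ≠ 0 ∧ ∀ I : Finset (Fin n), I ⊂ Finset.univ → I.card = k →
    1 - ∑ t : Fin (l + 1), η t *
      ((Pi.single (Fin.last (t : ℕ)) (1 : F) : Fin ((t : ℕ) + 1) → F) ⬝ᵥ
        ((toeplitz k α I t)⁻¹ *ᵥ coeffVec α I h t)) ≠ 0}

/-- `q(x) = x^{h-1} + ∑_{t=0}^l η_t x^{k+t-1}` (used for `1 ≤ h < k`). -/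
noncomputable def qPoly {k l : ℕ} (h : Fin k) (η : Fin (l + 1) → F) : F[X] :=
  X ^ ((h : ℕ) - 1) + ∑ t : Fin (l + 1), C (η t) * X ^ (k + (t : ℕ) - 1)

/-- `g(x) = ∏_{i=1}^{k-1} (x - α_i)`; the point `α_i` is `α` at the index of value `i - 1`. -/
noncomputable def gPoly {n : ℕ} (k : ℕ) (α : Fin n → F) : F[X] :=
  ∏ i ∈ Finset.univ.filter (fun i : Fin n => (i : ℕ) + 1 < k), (X - C (α i))

/-- `r_{h-1}`, the coefficient of `x^{h-1}` in `q(x) mod g(x)`. -/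
noncomputable def rCoeff {n k l : ℕ} (α : Fin n → F) (h : Fin k) (η : Fin (l + 1) → F) : F :=
  (qPoly h η %ₘ gPoly k α).coeff ((h : ℕ) - 1)

/-- `∑_{t=m}^l η_t η_{l+m-t}`. -/
def twistConv {l : ℕ} (m : ℕ) (η : Fin (l + 1) → F) : F :=
  ∑ t : Fin (l + 1), if ht : m ≤ (t : ℕ) then η t * η ⟨l + m - (t : ℕ), by omega⟩ else 0

end TwistedRS

namespace TwistedRS

/-! ### Node polynomials and twisted polynomials -/

section General

variable {F : Type*} [Field F]

/-! MDS: suppose `f` vanishes on `k` nodes with node polynomial `G`. Reducing `f` modulo `G`, the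
coefficient of `x^h` is `f_h` times the quantity that `Phi` keeps nonzero (`toeplitz_inv_apply`), so
`f_h = 0`; then `f` has degree below `k` and is zero. Hence a nonzero codeword has at most `k - 1`
zeros.

LCD: summing a polynomial of degree below `2n` over the roots of `x^n - λ` retains only its
coefficients at `x^0` and `x^n`. For a product `f g` of twisted polynomials the `x^n` coefficient is
`f_h g_h` times `twistConv m η`, which is zero. Since `v_i² = 1` off the first `k - 1` positions,
the dot product of two codewords is `n f_0 g_0 + ∑_{i<k} (v_i² - 1) f(α_i) g(α_i)`. The condition
`r_{h-1} ≠ 0` makes `f_0, f(α_1), …, f(α_{k-1})` coordinates on the message space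
(`eq_zero_of_rCoeff_ne_zero`). The form is diagonal in them with nonzero entries, so the hull is
zero. -/

lemma natDegree_prod_nodes {n : ℕ} (α : Fin n → F) (I : Finset (Fin n)) :
    (∏ i ∈ I, (X - C (α i))).natDegree = I.card := by
  simp

lemma monic_prod_nodes {n : ℕ} (α : Fin n → F) (I : Finset (Fin n)) :
    (∏ i ∈ I, (X - C (α i))).Monic :=
  monic_prod_of_monic _ _ fun _ _ => monic_X_sub_C _

lemma prod_nodes_dvd {n : ℕ} {α : Fin n → F} (hα : Function.Injective α) (I : Finset (Fin n))
    {p : F[X]} (hp : ∀ i ∈ I, p.eval (α i) = 0) : ∏ i ∈ I, (X - C (α i)) ∣ p := by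
  refine Finset.prod_dvd_of_coprime ?_ fun i hi => dvd_iff_isRoot.2 (hp i hi)
  intro _ _ _ _ hij
  exact pairwise_coprime_X_sub_C hα hij

/-- The polynomial `∑_i f_i x^i`. -/
noncomputable def lowPoly {k : ℕ} (f : Fin k → F) : F[X] :=
  ∑ i : Fin k, C (f i) * X ^ (i : ℕ)

lemma lowPoly_coeff {k : ℕ} (f : Fin k → F) (j : ℕ) :
    (lowPoly f).coeff j = if hj : j < k then f ⟨j, hj⟩ else 0 := by
  simp only [lowPoly, finsetSum_coeff, coeff_C_mul_X_pow]
  split_ifs with hj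
  · rw [Finset.sum_eq_single ⟨j, hj⟩]
    · simp
    · intro b _ hb
      rw [if_neg]
      rintro rfl
      exact hb rfl
    · simp
  · refine Finset.sum_eq_zero fun b _ => if_neg ?_
    have := b.2
    omega

lemma lowPoly_degree_lt {k : ℕ} (f : Fin k → F) : (lowPoly f).degree < k := by
  rw [degree_lt_iff_coeff_zero]
  intro j hj
  rw [lowPoly_coeff, dif_neg (by omega)]

lemma lowPoly_natDegree_le {k : ℕ} (f : Fin k → F) : (lowPoly f).natDegree ≤ k - 1 := by
  rw [natDegree_le_iff_coeff_eq_zero]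
  intro j hj
  rw [lowPoly_coeff, dif_neg (by omega)]

lemma twistedPoly_eq {k l : ℕ} (h : Fin k) (η : Fin (l + 1) → F) (f : Fin k → F) :
    twistedPoly h η f = lowPoly f + C (f h) * (X ^ k * lowPoly η) := by
  simp only [twistedPoly, lowPoly, Finset.mul_sum]
  congr 1
  refine Finset.sum_congr rfl fun t _ => ?_
  ring

lemma twistedPoly_natDegree_le {k l : ℕ} (h : Fin k) (η : Fin (l + 1) → F) (f : Fin k → F) :
    (twistedPoly h η f).natDegree ≤ k + l := by
  have h1 := lowPoly_natDegree_le f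
  have h2 := lowPoly_natDegree_le η
  rw [twistedPoly_eq]
  refine natDegree_add_le_of_degree_le (by omega) ?_
  refine (natDegree_C_mul_le _ _).trans (natDegree_mul_le.trans ?_)
  rw [natDegree_X_pow]
  omega

lemma twistedPoly_coeff_of_lt {k l : ℕ} (h : Fin k) (η : Fin (l + 1) → F) (f : Fin k → F)
    (j : Fin k) : (twistedPoly h η f).coeff j = f j := by
  rw [twistedPoly_eq, coeff_add, coeff_C_mul, coeff_X_pow_mul', if_neg (by omega), lowPoly_coeff,
    dif_pos j.2]
  simp

/-- Terms with `t < m` drop out because their partner index `l + m - t` exceeds `l`. -/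
lemma lowPoly_mul_self_coeff {l : ℕ} (m : ℕ) (η : Fin (l + 1) → F) :
    (lowPoly η * lowPoly η).coeff (l + m) = twistConv m η := by
  rw [coeff_mul, Finset.Nat.sum_antidiagonal_eq_sum_range_succ
    (fun i j => (lowPoly η).coeff i * (lowPoly η).coeff j), twistConv]
  have hsub : Finset.range (l + 1) ⊆ Finset.range (l + m).succ := by
    intro i hi
    simp only [Finset.mem_range] at hi ⊢
    omega
  rw [← Finset.sum_subset hsub, Finset.sum_range]
  · refine Finset.sum_congr rfl fun t _ => ?_
    have ht := t.2
    rw [lowPoly_coeff, lowPoly_coeff, dif_pos ht]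
    split_ifs with h1 h2 h2 <;> first | rfl | omega | simp
  · intro i _ hi
    rw [lowPoly_coeff, dif_neg (by simpa using hi), zero_mul]

/-- Only the product of the two twists reaches this degree: every product involving a low part has
degree at most `2k + l - 1`. -/
lemma twistedPoly_mul_coeff {k l : ℕ} (m : ℕ) (h : Fin k) (η : Fin (l + 1) → F)
    (f g : Fin k → F) :
    (twistedPoly h η f * twistedPoly h η g).coeff (2 * k + l + m) =
      f h * g h * twistConv m η := by
  have hk := h.2
  have key : twistedPoly h η f * twistedPoly h η g =
      lowPoly f * twistedPoly h η g + C (f h) * (X ^ k * lowPoly η * lowPoly g)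
        + C (f h * g h) * (X ^ (2 * k) * (lowPoly η * lowPoly η)) := by
    rw [C_mul]
    simp only [twistedPoly_eq]
    ring
  have hf := lowPoly_natDegree_le f
  have hg := lowPoly_natDegree_le g
  have hN := lowPoly_natDegree_le η
  have hT := twistedPoly_natDegree_le h η g
  rw [key, coeff_add, coeff_add, coeff_eq_zero_of_natDegree_lt, coeff_C_mul,
    coeff_eq_zero_of_natDegree_lt (p := X ^ k * lowPoly η * lowPoly g), coeff_C_mul,
    show 2 * k + l + m = (l + m) + 2 * k by ring, coeff_X_pow_mul, lowPoly_mul_self_coeff]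
  · ring
  · refine lt_of_le_of_lt natDegree_mul_le ?_
    have := natDegree_mul_le (p := X ^ k) (q := lowPoly η)
    rw [natDegree_X_pow] at this
    omega
  · refine lt_of_le_of_lt natDegree_mul_le ?_
    omega

/-! ### The Toeplitz condition as reduction modulo `k` nodes -/

open Matrix in
-- Divide: `x^{k+t} = G Q + R`. The coefficients of `Q` form the last row of the inverse Toeplitz
-- matrix, and pairing that row with `coeffVec` gives the coefficient of `x^h` in `G Q`.
lemma toeplitz_inv_apply {n k : ℕ} (α : Fin n → F) (I : Finset (Fin n)) (hI : I.card = k)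
    (h : Fin k) (t : ℕ) :
    (Pi.single (Fin.last t) (1 : F) : Fin (t + 1) → F) ⬝ᵥ
        ((toeplitz k α I t)⁻¹ *ᵥ coeffVec α I h t) =
      -(X ^ (k + t) %ₘ ∏ i ∈ I, (X - C (α i))).coeff h := by
  have hmon := monic_prod_nodes α I
  have hdeg := natDegree_prod_nodes α I
  rw [hI] at hdeg
  have hnode : ∀ j, nodeCoeff k α I j =
      if j ≤ k then (∏ i ∈ I, (X - C (α i))).coeff (k - j) else 0 := fun _ => rfl
  generalize hG : (∏ i ∈ I, (X - C (α i))) = G at *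
  have hh := h.2
  have hone : nodeCoeff k α I 0 = 1 := by
    rw [hnode, if_pos (Nat.zero_le _), Nat.sub_zero, ← hdeg]
    exact hmon
  have hdet : IsUnit (toeplitz k α I t).det := by
    rw [Matrix.det_of_isLowerTriangular]
    · simp [toeplitz, hone]
    · intro i j hij
      have : ¬ (j ≤ i) := not_le.2 (by simpa using hij)
      simp [toeplitz, this]
  have hdm := modByMonic_add_div (X ^ (k + t) : F[X]) G
  have hQdeg : (X ^ (k + t) /ₘ G).natDegree ≤ t := by
    rw [natDegree_divByMonic _ hmon, natDegree_X_pow, hdeg]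
    omega
  have hRdeg : (X ^ (k + t) %ₘ G).degree < k := by
    have := degree_modByMonic_lt (X ^ (k + t)) hmon
    rwa [degree_eq_natDegree hmon.ne_zero, hdeg] at this
  generalize (X ^ (k + t) /ₘ G) = Q at *
  generalize (X ^ (k + t) %ₘ G) = R at *
  have hcoeff : ∀ j, (G * Q).coeff j =
      ∑ a : Fin (t + 1), Q.coeff a * (if (a : ℕ) ≤ j then G.coeff (j - a) else 0) := by
    intro j
    conv_lhs => rw [Q.as_sum_range' (t + 1) (by omega)]
    rw [Finset.mul_sum, finsetSum_coeff, Finset.sum_range]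
    refine Finset.sum_congr rfl fun a _ => ?_
    rw [← C_mul_X_pow_eq_monomial, mul_left_comm, coeff_C_mul, coeff_mul_X_pow']
  -- Compare coefficients of `x^{k+j}`, where `R` contributes nothing.
  have hrow : (fun a : Fin (t + 1) => Q.coeff a) ᵥ* toeplitz k α I t =
      Pi.single (Fin.last t) 1 := by
    ext j
    have hj := j.2
    have e1 : (G * Q).coeff (k + j) = (X ^ (k + t) : F[X]).coeff (k + j) := by
      rw [← hdm, coeff_add, coeff_eq_zero_of_degree_lt (p := R), zero_add]
      exact lt_of_lt_of_le hRdeg (by exact_mod_cast Nat.le_add_right _ _)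
    have e2 : (X ^ (k + t) : F[X]).coeff (k + j) =
        (Pi.single (Fin.last t) 1 : Fin (t + 1) → F) j := by
      rw [coeff_X_pow, Pi.single_apply]
      congr 1
      rw [Fin.ext_iff, Fin.val_last]
      simp
    rw [← e2, ← e1, hcoeff]
    simp only [vecMul, dotProduct, toeplitz, Matrix.of_apply]
    refine Finset.sum_congr rfl fun a _ => ?_
    congr 1
    have ha := a.2
    rw [hnode]
    by_cases hja : j ≤ a
    · have hja' : (j : ℕ) ≤ a := hja
      rw [if_pos hja]
      by_cases hk : (a : ℕ) - j ≤ k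
      · rw [if_pos hk, if_pos (by omega)]
        congr 1
        omega
      · rw [if_neg hk, if_neg (by omega)]
    · have hja' : ¬ (j : ℕ) ≤ a := hja
      rw [if_neg hja, if_pos (by omega), coeff_eq_zero_of_natDegree_lt]
      omega
  rw [← hrow, ← Matrix.dotProduct_mulVec, Matrix.mulVec_mulVec, Matrix.mul_nonsing_inv _ hdet,
    Matrix.one_mulVec]
  -- Since `h < k`, the monomial `x^{k+t}` has no `x^h` term.
  have e3 : (G * Q).coeff h = -R.coeff h := by
    have : (R + G * Q).coeff h = 0 := by
      rw [hdm, coeff_X_pow, if_neg (by omega)]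
    rw [coeff_add] at this
    linear_combination this
  rw [← e3, hcoeff]
  simp only [dotProduct, coeffVec]
  refine Finset.sum_congr rfl fun a _ => ?_
  congr 1
  rw [hnode]
  by_cases ha : (a : ℕ) ≤ h
  · rw [if_pos ha, if_pos (by omega)]
    congr 1
    omega
  · rw [if_neg ha, if_neg (by omega)]

lemma eq_zero_of_lowPoly_dvd {k d : ℕ} (f : Fin k → F) {G : F[X]} (hd : G.natDegree = d)
    (hkd : k ≤ d) (hG : G ≠ 0) (hdvd : G ∣ lowPoly f) : f = 0 := by
  have h0 : lowPoly f = 0 := by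
    refine eq_zero_of_dvd_of_degree_lt hdvd (lt_of_lt_of_le (lowPoly_degree_lt f) ?_)
    rw [degree_eq_natDegree hG, hd]
    exact_mod_cast hkd
  ext j
  have := lowPoly_coeff f j
  rw [h0, coeff_zero, dif_pos j.2] at this
  exact this.symm

lemma eq_zero_of_twistedPoly_eval {n k l : ℕ} {α : Fin n → F} (hα : Function.Injective α)
    (h : Fin k) {η : Fin (l + 1) → F} (hΦ : η ∈ Phi l α h) (hkn : k < n)
    (I : Finset (Fin n)) (hI : I.card = k) (f : Fin k → F)
    (hf : ∀ i ∈ I, (twistedPoly h η f).eval (α i) = 0) : f = 0 := by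
  have hdvd := prod_nodes_dvd hα I hf
  have hmon := monic_prod_nodes α I
  have hdeg := natDegree_prod_nodes α I
  have hss : I ⊂ Finset.univ := by
    rw [Finset.ssubset_univ_iff]
    rintro rfl
    simp at hI
    omega
  have hne := hΦ.2 I hss hI
  simp only [toeplitz_inv_apply α I hI h] at hne
  rw [hI] at hdeg
  generalize (∏ i ∈ I, (X - C (α i))) = G at *
  have hGdeg : G.degree = k := by rw [degree_eq_natDegree hmon.ne_zero, hdeg]
  have hfh : f h = 0 := by
    have h0 := congrArg (fun p => coeff p (h : ℕ)) ((modByMonic_eq_zero_iff_dvd hmon).2 hdvd)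
    rw [twistedPoly_eq] at h0
    have hsum : X ^ k * lowPoly η = ∑ t : Fin (l + 1), η t • (X ^ (k + (t : ℕ)) : F[X]) := by
      rw [lowPoly, Finset.mul_sum]
      refine Finset.sum_congr rfl fun t _ => ?_
      rw [smul_eq_C_mul]
      ring
    have hlow : lowPoly f %ₘ G = lowPoly f :=
      (modByMonic_eq_self_iff hmon).2 (hGdeg ▸ lowPoly_degree_lt f)
    have hmod : (∑ t : Fin (l + 1), η t • (X ^ (k + (t : ℕ)) : F[X])) %ₘ G =
        ∑ t : Fin (l + 1), η t • (X ^ (k + (t : ℕ)) %ₘ G) := by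
      change modByMonicHom G _ = _
      rw [map_sum]
      exact Finset.sum_congr rfl fun t _ => smul_modByMonic _ _
    rw [hsum, ← smul_eq_C_mul, add_modByMonic, smul_modByMonic, hlow, hmod] at h0
    simp only [coeff_add, coeff_smul, finsetSum_coeff, smul_eq_mul, coeff_zero, lowPoly_coeff,
      h.2, dif_pos, Fin.eta] at h0
    refine (mul_eq_zero.1 (?_ : f h * _ = 0)).resolve_right hne
    simp only [mul_neg, Finset.sum_neg_distrib]
    linear_combination h0
  rw [twistedPoly_eq, hfh, C_0, zero_mul, add_zero] at hdvd
  exact eq_zero_of_lowPoly_dvd f hdeg le_rfl hmon.ne_zero hdvd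

/-! ### The constant term and `k - 1` values as coordinates -/

lemma card_filter_succ_lt {n k : ℕ} (hk : k ≤ n) (hk0 : 1 ≤ k) :
    (Finset.univ.filter fun i : Fin n => (i : ℕ) + 1 < k).card = k - 1 := by
  have : (Finset.univ.filter fun i : Fin n => (i : ℕ) + 1 < k) =
      Finset.univ.filter fun i : Fin n => (i : ℕ) < k - 1 := by
    ext i
    simp only [Finset.mem_filter, Finset.mem_univ, true_and]
    omega
  rw [this, Fin.card_filter_val_lt]
  omega

/-- As `f_0 = 0` and the nodes are nonzero, `f / x` is still divisible by `gPoly`; its remainder has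
`x^{h-1}` coefficient `f_h r_{h-1}`, which forces `f_h = 0`. -/
lemma eq_zero_of_rCoeff_ne_zero {n k l : ℕ} {α : Fin n → F} (hα : Function.Injective α)
    (hα0 : ∀ i, α i ≠ 0) (h : Fin k) (hh : 1 ≤ (h : ℕ)) {η : Fin (l + 1) → F}
    (hr : rCoeff α h η ≠ 0) (hkn : k ≤ n) (f : Fin k → F)
    (hf0 : f ⟨0, by omega⟩ = 0)
    (hf : ∀ i : Fin n, (i : ℕ) + 1 < k → (twistedPoly h η f).eval (α i) = 0) : f = 0 := by
  have hk := h.2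
  obtain ⟨k, rfl⟩ : ∃ k', k = k' + 1 := ⟨k - 1, by omega⟩
  let f' : Fin k → F := fun i => f i.succ
  have hmon : (gPoly (k + 1) α).Monic := monic_prod_nodes α _
  have hdeg : (gPoly (k + 1) α).natDegree = k := by
    rw [gPoly, natDegree_prod_nodes, card_filter_succ_lt hkn (by omega)]
    omega
  have hGdeg : (gPoly (k + 1) α).degree = k := by rw [degree_eq_natDegree hmon.ne_zero, hdeg]
  have hlow : lowPoly f = X * lowPoly f' := by
    rw [lowPoly, Fin.sum_univ_succ, lowPoly, Finset.mul_sum]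
    have : f 0 = 0 := hf0
    simp only [this, C_0, zero_mul, zero_add, Fin.val_succ, f']
    refine Finset.sum_congr rfl fun t _ => ?_
    ring
  have hX : twistedPoly h η f = X * (lowPoly f' + C (f h) * (X ^ k * lowPoly η)) := by
    rw [twistedPoly_eq, hlow]
    ring
  have hdvd : gPoly (k + 1) α ∣ lowPoly f' + C (f h) * (X ^ k * lowPoly η) := by
    refine prod_nodes_dvd hα _ fun i hi => ?_
    have := hf i (Finset.mem_filter.1 hi).2
    rw [hX, eval_mul, eval_X] at this
    exact (mul_eq_zero.1 this).resolve_left (hα0 i)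
  have hq : qPoly h η = X ^ ((h : ℕ) - 1) + X ^ k * lowPoly η := by
    rw [qPoly, lowPoly, Finset.mul_sum]
    congr 1
    refine Finset.sum_congr rfl fun t _ => ?_
    rw [show k + 1 + (t : ℕ) - 1 = k + t by omega]
    ring
  have hh1 : (h : ℕ) - 1 < k := by omega
  have hf'h : f' ⟨(h : ℕ) - 1, hh1⟩ = f h := by
    simp only [f']
    congr 1
    ext
    simp only [Fin.val_succ]
    omega
  have hfh : f h = 0 := by
    have h0 := congrArg (fun p => coeff p ((h : ℕ) - 1)) ((modByMonic_eq_zero_iff_dvd hmon).2 hdvd)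
    -- The first summand is already reduced and has no `x^{h-1}` term, so only `f_h q` contributes
    -- there.
    have hsplit : lowPoly f' + C (f h) * (X ^ k * lowPoly η) =
        (lowPoly f' - C (f h) * X ^ ((h : ℕ) - 1)) + f h • qPoly h η := by
      rw [hq, smul_eq_C_mul]
      ring
    have hself : (lowPoly f' - C (f h) * X ^ ((h : ℕ) - 1)) %ₘ gPoly (k + 1) α =
        lowPoly f' - C (f h) * X ^ ((h : ℕ) - 1) := by
      refine (modByMonic_eq_self_iff hmon).2 ?_
      rw [hGdeg]
      refine lt_of_le_of_lt (degree_sub_le _ _) (max_lt (lowPoly_degree_lt f') ?_)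
      exact lt_of_le_of_lt (degree_C_mul_X_pow_le _ _) (by exact_mod_cast hh1)
    rw [hsplit, add_modByMonic, smul_modByMonic, hself] at h0
    simp only [coeff_add, coeff_sub, coeff_smul, smul_eq_mul, coeff_zero, lowPoly_coeff, hh1,
      dif_pos, hf'h, coeff_C_mul_X_pow, if_true, sub_self, zero_add] at h0
    exact (mul_eq_zero.1 h0).resolve_right hr
  rw [hfh, C_0, zero_mul, add_zero] at hdvd
  have hf' := eq_zero_of_lowPoly_dvd f' hdeg le_rfl hmon.ne_zero hdvd
  ext i
  refine Fin.cases ?_ (fun j => ?_) i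
  · exact hf0
  · exact congrFun hf' j

/-- The encoding map `f ↦ (v_1 f(α_1), …, v_n f(α_n))`. -/
noncomputable def encode {n k l : ℕ} (α v : Fin n → F) (h : Fin k) (η : Fin (l + 1) → F) :
    (Fin k → F) →ₗ[F] (Fin n → F) where
  toFun f := fun i => v i * (twistedPoly h η f).eval (α i)
  map_add' f g := by
    ext i
    simp only [twistedPoly, Pi.add_apply, eval_add, eval_mul, eval_C, eval_finsetSum, eval_pow,
      eval_X, add_mul, Finset.sum_add_distrib]
    ring
  map_smul' a f := by
    ext i
    simp only [twistedPoly, Pi.smul_apply, smul_eq_mul, eval_add, eval_mul, eval_C,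
      eval_finsetSum, eval_pow, eval_X, mul_assoc, ← Finset.mul_sum, RingHom.id_apply]
    ring

lemma tgrsCode_eq_range {n k l : ℕ} (α v : Fin n → F) (h : Fin k) (η : Fin (l + 1) → F) :
    tgrsCode α v h η = LinearMap.range (encode α v h η) := by
  ext c
  constructor
  · rintro ⟨f, rfl⟩
    exact ⟨f, rfl⟩
  · rintro ⟨f, rfl⟩
    exact ⟨f, rfl⟩

/-! ### Minimum distance -/

lemma minDist_range [DecidableEq F] {n k : ℕ} (hk : 1 ≤ k) (hkn : k ≤ n)
    (E : (Fin k → F) →ₗ[F] (Fin n → F))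
    (hE : ∀ (I : Finset (Fin n)), I.card = k → ∀ f, (∀ i ∈ I, E f i = 0) → f = 0) :
    minDist (LinearMap.range E) = n + 1 - k := by
  have hlow : ∀ f, f ≠ 0 → n + 1 - k ≤ hammingNorm (E f) := by
    intro f hf
    by_contra hlt
    have hsum := Finset.card_filter_add_card_filter_not (s := (Finset.univ : Finset (Fin n)))
      (fun i => E f i ≠ 0)
    have hn : (Finset.univ.filter fun i => E f i ≠ 0).card = hammingNorm (E f) := rfl
    rw [hn, Finset.card_univ, Fintype.card_fin] at hsum
    obtain ⟨I, hIs, hI⟩ := Finset.exists_subset_card_eq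
      (s := Finset.univ.filter fun i => ¬ E f i ≠ 0) (n := k) (by omega)
    refine hf (hE I hI f fun i hi => ?_)
    have := (Finset.mem_filter.1 (hIs hi)).2
    exact not_not.1 this
  obtain ⟨f, hf0, hf⟩ : ∃ f ≠ 0, hammingNorm (E f) ≤ n + 1 - k := by
    -- A map from dimension `k` to `k - 1` has a kernel, giving a codeword that is zero in the first
    -- `k - 1` positions.
    let P : (Fin k → F) →ₗ[F] (Fin (k - 1) → F) :=
      LinearMap.pi fun j => LinearMap.proj (Fin.castLE (by omega) j) ∘ₗ E
    have hker : LinearMap.ker P ≠ ⊥ := LinearMap.ker_ne_bot_of_finrank_lt (by simp; omega)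
    obtain ⟨f, hfP, hf0⟩ := Submodule.exists_mem_ne_zero_of_ne_bot hker
    refine ⟨f, hf0, ?_⟩
    have hz : ∀ i : Fin n, (i : ℕ) + 1 < k → E f i = 0 := by
      intro i hi
      exact congrFun (LinearMap.mem_ker.1 hfP) ⟨i, by omega⟩
    have hsub : (Finset.univ.filter fun i => E f i ≠ 0) ⊆
        Finset.univ.filter fun i : Fin n => ¬ ((i : ℕ) + 1 < k) := by
      intro i hi
      simp only [Finset.mem_filter, Finset.mem_univ, true_and] at hi ⊢
      exact fun hlt => hi (hz i hlt)
    have hsum := Finset.card_filter_add_card_filter_not (s := (Finset.univ : Finset (Fin n)))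
      (fun i => (i : ℕ) + 1 < k)
    rw [card_filter_succ_lt hkn hk, Finset.card_univ, Fintype.card_fin] at hsum
    refine (Finset.card_le_card hsub).trans ?_
    omega
  have hne : E f ≠ 0 := by
    intro h0
    have := hlow f hf0
    rw [h0, hammingNorm_zero] at this
    omega
  refine le_antisymm (Nat.sInf_le ?_) ?_
  · exact ⟨E f, ⟨f, rfl⟩, 0, zero_mem _, hne, by
      rw [hammingDist_zero_right]
      exact le_antisymm hf (hlow f hf0)⟩
  · refine le_csInf ⟨_, E f, ⟨f, rfl⟩, 0, zero_mem _, hne, rfl⟩ ?_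
    rintro d ⟨_, ⟨a, rfl⟩, _, ⟨b, rfl⟩, hab, rfl⟩
    rw [hammingDist_eq_hammingNorm, ← map_neg, ← map_add]
    refine hlow _ fun h0 => hab ?_
    rw [neg_add_eq_zero] at h0
    rw [h0]

end General

/-! ### Power sums over the roots of `x^n - λ`, and the hull -/

section Finite

variable {F : Type*} [Field F] [Fintype F]

lemma natCast_ne_zero_of_dvd_card_sub_one {n : ℕ} (hn : n ∣ Fintype.card F - 1) :
    (n : F) ≠ 0 := by
  intro h0
  obtain ⟨d, hd⟩ := hn
  have hq : Fintype.card F = n * d + 1 := by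
    have := Fintype.card_pos (α := F)
    omega
  have := FiniteField.cast_card_eq_zero F
  rw [hq] at this
  push_cast at this
  rw [h0, zero_mul, zero_add] at this
  exact one_ne_zero this

lemma exists_isPrimitiveRoot_of_dvd_card_sub_one {n : ℕ} (hn : n ∣ Fintype.card F - 1) :
    ∃ ζ : F, IsPrimitiveRoot ζ n := by
  classical
  obtain ⟨g, hg⟩ := IsCyclic.exists_ofOrder_eq_natCard (α := Fˣ)
  rw [Nat.card_eq_fintype_card, Fintype.card_units] at hg
  have hp := (IsPrimitiveRoot.orderOf g).map_of_injective
    (f := Units.coeHom F) Units.coeHom_injective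
  rw [hg] at hp
  obtain ⟨d, hd⟩ := hn
  have hpos : 0 < Fintype.card F - 1 := by
    have := Fintype.one_lt_card (α := F)
    omega
  exact ⟨_, hp.pow hpos (by rw [hd, mul_comm])⟩

/-- Multiplication by a primitive `n`-th root of unity `ζ` permutes the roots, so the sum equals
`ζ^j` times itself, and `ζ^j ≠ 1`. -/
lemma sum_roots_pow_eq_zero {n : ℕ} (hn : n ∣ Fintype.card F - 1) {lam : F} {α : Fin n → F}
    (hα : Function.Injective α) (hroots : ∀ x : F, x ^ n = lam ↔ ∃ i, α i = x)
    {j : ℕ} (hj : ¬ n ∣ j) : ∑ i, α i ^ j = 0 := by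
  classical
  obtain ⟨ζ, hζ⟩ := exists_isPrimitiveRoot_of_dvd_card_sub_one hn
  have hmem : ∀ i, ∃ i', α i' = ζ * α i := fun i => by
    rw [← hroots, mul_pow, hζ.pow_eq_one, one_mul, hroots]
    exact ⟨i, rfl⟩
  choose σ hσ using hmem
  have hn0 : n ≠ 0 := by
    rintro rfl
    have := Fintype.one_lt_card (α := F)
    rw [zero_dvd_iff] at hn
    omega
  have hσi : Function.Injective σ := by
    intro a b hab
    have h1 : ζ * α a = ζ * α b := by rw [← hσ, ← hσ, hab]
    exact hα (mul_left_cancel₀ (hζ.ne_zero hn0) h1)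
  have hσb : Function.Bijective σ := Finite.injective_iff_bijective.1 hσi
  have hS : ∑ i, α i ^ j = ζ ^ j * ∑ i, α i ^ j := by
    conv_lhs => rw [← hσb.sum_comp]
    rw [Finset.mul_sum]
    exact Finset.sum_congr rfl fun i _ => by rw [hσ, mul_pow]
  have h1 : (1 - ζ ^ j) * ∑ i, α i ^ j = 0 := by linear_combination hS
  refine (mul_eq_zero.1 h1).resolve_left fun h2 => hj ?_
  exact (hζ.pow_eq_one_iff_dvd j).1 (sub_eq_zero.1 h2).symm

lemma sum_roots_eval {n : ℕ} (hn : n ∣ Fintype.card F - 1) {lam : F} {α : Fin n → F}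
    (hα : Function.Injective α) (hroots : ∀ x : F, x ^ n = lam ↔ ∃ i, α i = x)
    (p : F[X]) (hp : p.natDegree < 2 * n) :
    ∑ i, p.eval (α i) = n * (p.coeff 0 + lam * p.coeff n) := by
  have hn0 : 0 < n := by omega
  have hαn : ∀ i, α i ^ n = lam := fun i => (hroots _).2 ⟨i, rfl⟩
  simp only [eval_eq_sum_range' hp]
  rw [Finset.sum_comm]
  simp only [← Finset.mul_sum]
  rw [← Finset.sum_subset (s₁ := {0, n})]
  · rw [Finset.sum_pair hn0.ne]
    simp [hαn]
    ring
  · intro j hj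
    simp only [Finset.mem_insert, Finset.mem_singleton] at hj
    simp only [Finset.mem_range]
    omega
  · intro j hj hj'
    rw [sum_roots_pow_eq_zero hn hα hroots, mul_zero]
    rintro ⟨c, rfl⟩
    simp only [Finset.mem_insert, Finset.mem_singleton, Finset.mem_range] at hj hj'
    have hc : c < 2 := by
      rw [mul_comm 2 n] at hj
      exact lt_of_mul_lt_mul_left hj (Nat.zero_le _)
    interval_cases c <;> simp at hj'

lemma isLCD_tgrsCode {n k l m : ℕ} (hnk : n = 2 * k + l + m)
    (hn : n ∣ Fintype.card F - 1) {lam : F} (hlam : lam ≠ 0)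
    (h : Fin k) (hh : 1 ≤ (h : ℕ)) {α : Fin n → F} (hα : Function.Injective α)
    (hroots : ∀ x : F, x ^ n = lam ↔ ∃ i, α i = x) {v : Fin n → F}
    (hv₁ : ∀ i : Fin n, (i : ℕ) + 1 < k → v i ≠ -1 ∧ v i ≠ 0 ∧ v i ≠ 1)
    (hv₂ : ∀ i : Fin n, k ≤ (i : ℕ) + 1 → v i = 1 ∨ v i = -1)
    {η : Fin (l + 1) → F} (hr : rCoeff α h η ≠ 0) (hη : twistConv m η = 0) :
    IsLCD (tgrsCode α v h η) := by
  have hk := h.2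
  have hα0 : ∀ i, α i ≠ 0 := by
    intro i h0
    have := (hroots (α i)).2 ⟨i, rfl⟩
    rw [h0, zero_pow (by omega)] at this
    exact hlam this.symm
  rw [IsLCD, eq_bot_iff]
  rintro c ⟨⟨f, rfl⟩, hc⟩
  -- Write `v_i² = 1 + (v_i² - 1)`: the constant part sums to `n f_0 g_0`, the `x^n` coefficient
  -- being zero by `hη`.
  have horth : ∀ g : Fin k → F,
      n * (f ⟨0, by omega⟩ * g ⟨0, by omega⟩) + ∑ i : Fin n, (v i ^ 2 - 1) *
        ((twistedPoly h η f).eval (α i) * (twistedPoly h η g).eval (α i)) = 0 := by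
    intro g
    have h1 := hc _ ⟨g, rfl⟩
    have h2 : ∑ i : Fin n, (v i * (twistedPoly h η g).eval (α i)) *
        (v i * (twistedPoly h η f).eval (α i)) = 0 := h1
    have hdeg : (twistedPoly h η f * twistedPoly h η g).natDegree < 2 * n := by
      have h3 := twistedPoly_natDegree_le h η f
      have h4 := twistedPoly_natDegree_le h η g
      refine lt_of_le_of_lt natDegree_mul_le ?_
      omega
    have h5 := sum_roots_eval hn hα hroots _ hdeg
    have h6 := twistedPoly_mul_coeff m h η f g
    rw [← hnk, hη, mul_zero] at h6
    have h7 := twistedPoly_coeff_of_lt h η f ⟨0, by omega⟩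
    have h8 := twistedPoly_coeff_of_lt h η g ⟨0, by omega⟩
    rw [h6, mul_coeff_zero, h7, h8, mul_zero, add_zero] at h5
    rw [← h5, ← h2, ← Finset.sum_add_distrib]
    refine Finset.sum_congr rfl fun i _ => ?_
    rw [eval_mul]
    ring
  -- The coordinates `(g_0, g(α_1), …, g(α_{k-1}))`. Injectivity and equal dimensions give
  -- surjectivity, so test messages `g` dual to each coordinate exist.
  let P : (Fin k → F) →ₗ[F] F × (Fin (k - 1) → F) :=
    (LinearMap.proj ⟨0, by omega⟩).prod (LinearMap.pi fun j =>
      LinearMap.proj (Fin.castLE (by omega) j) ∘ₗ encode α (fun _ => 1) h η)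
  have hP1 : ∀ g, (P g).1 = g ⟨0, by omega⟩ := fun _ => rfl
  have hP2 : ∀ g (i : Fin n) (hi : (i : ℕ) + 1 < k),
      (P g).2 ⟨i, by omega⟩ = (twistedPoly h η g).eval (α i) := fun _ _ _ => one_mul _
  have hPi : Function.Injective P := by
    rw [injective_iff_map_eq_zero]
    intro g hg
    refine eq_zero_of_rCoeff_ne_zero hα hα0 h hh hr (by omega) g ?_ fun i hi => ?_
    · rw [← hP1 g, hg]
      rfl
    · rw [← hP2 g i hi, hg]
      rfl
  have hPs : Function.Surjective P :=
    (LinearMap.injective_iff_surjective_of_finrank_eq_finrank (by simp; omega)).1 hPi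
  have hone : ∀ i : Fin n, ¬ ((i : ℕ) + 1 < k) → v i ^ 2 - 1 = 0 := by
    intro i hi
    rcases hv₂ i (by omega) with hv | hv <;> rw [hv] <;> ring
  have hf0 : f ⟨0, by omega⟩ = 0 := by
    obtain ⟨g, hg⟩ := hPs (1, 0)
    have h1 := horth g
    rw [← hP1 g, hg, Finset.sum_eq_zero, add_zero, mul_one] at h1
    · exact (mul_eq_zero.1 h1).resolve_left (natCast_ne_zero_of_dvd_card_sub_one hn)
    · intro i _
      by_cases hi : (i : ℕ) + 1 < k
      · rw [← hP2 g i hi, hg]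
        simp
      · rw [hone i hi, zero_mul]
  have hf : ∀ i : Fin n, (i : ℕ) + 1 < k → (twistedPoly h η f).eval (α i) = 0 := by
    intro i hi
    -- Against this `g` only the term `(v_i² - 1) f(α_i)` survives.
    obtain ⟨g, hg⟩ := hPs (0, Pi.single ⟨i, by omega⟩ 1)
    have h1 := horth g
    rw [hf0, zero_mul, mul_zero, zero_add, Finset.sum_eq_single i] at h1
    · rw [← hP2 g i hi, hg] at h1
      simp only [Pi.single_eq_same, mul_one] at h1
      refine (mul_eq_zero.1 h1).resolve_left fun h2 => ?_
      have h3 : (v i - 1) * (v i + 1) = 0 := by linear_combination h2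
      rcases mul_eq_zero.1 h3 with h4 | h4
      · exact (hv₁ i hi).2.2 (sub_eq_zero.1 h4)
      · exact (hv₁ i hi).1 (eq_neg_of_add_eq_zero_left h4)
    · intro j _ hji
      by_cases hj : (j : ℕ) + 1 < k
      · rw [← hP2 g j hj, hg]
        have : (j : ℕ) ≠ i := fun e => hji (Fin.ext e)
        simp [this]
      · rw [hone j hj, zero_mul]
    · simp
  have : f = 0 := eq_zero_of_rCoeff_ne_zero hα hα0 h hh hr (by omega) f hf0 hf
  subst this
  exact (encode α v h η).map_zero

end Finite

end TwistedRS

theorem mainTheorem6 {F : Type*} [Field F] [Fintype F] [DecidableEq F]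
    (n k l m : ℕ) (hm : m ≤ l) (hk : 2 ≤ k) (hnk : n = 2 * k + l + m)
    (hn : n ∣ Fintype.card F - 1)
    (lam : F) (hlam : lam ≠ 0) (hord : orderOf lam ∣ (Fintype.card F - 1) / n)
    (h : Fin k) (hh : 1 ≤ (h : ℕ))
    (α : Fin n → F) (hα : Function.Injective α)
    (hroots : ∀ x : F, x ^ n = lam ↔ ∃ i, α i = x)
    (v : Fin n → F)
    (hv₁ : ∀ i : Fin n, (i : ℕ) + 1 < k → v i ≠ -1 ∧ v i ≠ 0 ∧ v i ≠ 1)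
    (hv₂ : ∀ i : Fin n, k ≤ (i : ℕ) + 1 → v i = 1 ∨ v i = -1)
    (η : Fin (l + 1) → F)
    (hr : TwistedRS.rCoeff α h η ≠ 0)
    (hη : TwistedRS.twistConv m η = 0)
    (hΦ : η ∈ TwistedRS.Phi l α h) :
    Module.finrank F (TwistedRS.tgrsCode α v h η) = k ∧
      TwistedRS.IsLCD (TwistedRS.tgrsCode α v h η) ∧
      TwistedRS.IsMDS (TwistedRS.tgrsCode α v h η) := by
  have hk1 := h.2
  have hkn : k < n := by omega
  have hv0 : ∀ i, v i ≠ 0 := by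
    intro i
    by_cases hi : (i : ℕ) + 1 < k
    · exact (hv₁ i hi).2.1
    · rcases hv₂ i (by omega) with hv | hv <;> rw [hv] <;> simp
  have hE : ∀ I : Finset (Fin n), I.card = k → ∀ f,
      (∀ i ∈ I, TwistedRS.encode α v h η f i = 0) → f = 0 := by
    intro I hI f hf
    refine TwistedRS.eq_zero_of_twistedPoly_eval hα h hΦ hkn I hI f fun i hi => ?_
    -- Nonzero multipliers turn zeros of the codeword into roots of the polynomial.
    exact (mul_eq_zero.1 (hf i hi)).resolve_left (hv0 i)
  have hinj : Function.Injective (TwistedRS.encode α v h η) := by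
    rw [injective_iff_map_eq_zero]
    intro f hf
    obtain ⟨I, -, hI⟩ := Finset.exists_subset_card_eq
      (s := (Finset.univ : Finset (Fin n))) (n := k) (by simp; omega)
    exact hE I hI f fun i _ => congrFun hf i
  have hdim : Module.finrank F (TwistedRS.tgrsCode α v h η) = k := by
    rw [TwistedRS.tgrsCode_eq_range, LinearMap.finrank_range_of_inj hinj, Module.finrank_fin_fun]
  refine ⟨hdim, TwistedRS.isLCD_tgrsCode hnk hn hlam h hh hα hroots hv₁ hv₂ hr hη, ?_⟩
  rw [TwistedRS.IsMDS, hdim, TwistedRS.tgrsCode_eq_range,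
    TwistedRS.minDist_range (by omega) hkn.le _ hE]
  omega
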